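/- Let $\langle\cdot,\cdot\rangle$ be the symmetric bilinear form $\langle x,y\rangle=x_1y_1+x_2y_2+x_3y_3+x_4y_4-x_5y_5-x_6y_6$ on $\mathbb R^{6}$, with standard basis $e_1,\dots,e_6$, let $\mathcal L^4=\{[x]\in\mathbb R\mathrm P^5:\langle x,x\rangle=0\}$ be the Lie quadric, and let $\perp$ denote polarity with respect to $\mathcal L^4$. Dimensions of subspaces of $\mathbb R\mathrm P^5$ are projective. For a net $l$ of subspaces $l_{i,j}$ of $\mathbb R\mathrm P^5$, $(i,j)\in\mathbb Z^2$, put $$\mathcal L_Al(i,j)=(l_{i,j}\vee l_{i+1,j})\cap(l_{i,j+1}\vee l_{i+1,j+1}),\qquad \mathcal L_Bl(i,j)=(l_{i,j}\vee l_{i,j+1})\cap(l_{i+1,j}\vee l_{i+1,j+1}).$$ A discrete line congruence is a net of lines in which any two neighbouring lines $l_{i,j},l_{i+1,j}$ and $l_{i,j},l_{i,j+1}$ meet in exactly one point. A principal contact element net is a discrete line congruence all of whose lines lie in $\mathcal L^4$. It has two families of spherical parameter lines if for every $j$ the join $\bigvee_i l_{i,j}$ is $4$-dimensional and $O_j:=\bigcap_i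 (l_{i,j}\vee l_{i,j+1})$ is a point, and for every $i$ the join $\bigvee_j l_{i,j}$ is $4$-dimensional and $O'_i:=\bigcap_j (l_{i,j}\vee l_{i+1,j})$ is a point. **Theorem.** Let $l$ be a principal contact element net with two families of spherical parameter lines. Assume the following genericity: $\mathcal L_Al$ and $\mathcal L_Bl$ are discrete line congruences, $\mathcal L_A^2l$ and $\mathcal L_B^2l$ are nets of lines, and for all $i,j$ the point $O_j$ lies neither on $l_{i,j}$ nor on $l_{i,j+1}$, and $O'_i$ lies neither on $l_{i,j}$ nor on $l_{i+1,j}$. Then: 1. $\mathcal L_A^2l$ and $\mathcal L_B^2l$ are Laplace degenerate: $\mathcal L_A^2l(i,j)$ does not depend on $j$, and $\mathcal L_B^2l(i,j)$ does not depend on $i$. 2. There are $2$-dimensional projective planes $Y,X\subset\mathbb R\mathrm P^5$ that are conjugate with respect to $\mathcal L^4$ (every point of $Y$ is conjugate to every point of $X$) such that $(\bigvee_i l_{i,j})^\perp\in Y$ for all $j$ and $(\bigvee_j l_{i,j})^\perp\in X$ for all $i$. 3. Suppose that every contact element has a finite point, i.e. there is a net $P:\mathbb Z^2\to\mathbb R^3$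 with $l_{i,j}\cap[e_6]^\perp=[\hat P_{i,j}]$, where $\hat P=\bigl(P,\tfrac{|P|^2-1}{2},\tfrac{|P|^2+1}{2},0\bigr)$, and that no parameter line $\{P_{i,j}\}_{i\in\mathbb Z}$ or $\{P_{i,j}\}_{j\in\mathbb Z}$ is contained in a plane. Then for each $j$ there is exactly one sphere $\mathcal H_j$ through the points $\{P_{i,j}\}_{i\in\mathbb Z}$, for each $i$ there is exactly one sphere $\mathcal V_i$ through the points $\{P_{i,j}\}_{j\in\mathbb Z}$, and: - If the centres of the spheres $\mathcal H_j$ are not collinear, then the spheres $\mathcal H_j$ have exactly two common, possibly imaginary, points, counted with multiplicity: the set of common points in $\mathbb C^3$ of the complexified spheres is $\{z,w\}$ for some $z,w$, and $z=w$ is possible only if all the spheres are tangent to one line at a common point. The same holds for the spheres $\mathcal V_i$ if their centres are not collinear. - There are planes $E,F\subset\mathbb R^3$ that are orthogonal to each other such that the centres of all $\mathcal H_j$ lie in $E$ and the centres of all $\mathcal V_i$ lie in $F$. -/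

import Mathlib

/-- The symmetric bilinear form of signature `(4, 2)` on `ℝ⁶ = ℝ^{4,2}`. The Lie quadric is the set
of points `[x]` of the projective space of `ℝ⁶` with `lieForm x x = 0`. The basis `e₁, …, e₆` is
indexed by `0, …, 5`. -/
noncomputable def lieForm : LinearMap.BilinForm ℝ (Fin 6 → ℝ) :=
  Matrix.toBilin' (Matrix.diagonal ![1, 1, 1, 1, -1, -1])

/-- Maps from `ℤ²` to the projective subspaces of `ℝP⁵`. A `d`-dimensional projective subspace is
a linear subspace of `ℝ⁶` of dimension `d + 1`. -/
abbrev SubspaceNet : Type := ℤ → ℤ → Submodule ℝ (Fin 6 → ℝ)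

/-- All members of the net are projective lines. -/
def IsLineNet (l : SubspaceNet) : Prop :=
  ∀ i j, Module.finrank ℝ (l i j) = 2

/-- A discrete line congruence: any two neighbouring lines intersect (in exactly one point). -/
structure IsDiscreteLineCongruence (l : SubspaceNet) : Prop where
  isLineNet : IsLineNet l
  meet_fst : ∀ i j, Module.finrank ℝ ↥(l i j ⊓ l (i + 1) j) = 1
  meet_snd : ∀ i j, Module.finrank ℝ ↥(l i j ⊓ l i (j + 1)) = 1

/-- A principal contact element net: a discrete line congruence all of whose lines lie in the
Lie quadric. -/
structure IsPrincipalContactElementNet (l : SubspaceNet) : Prop where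
  congruence : IsDiscreteLineCongruence l
  isotropic : ∀ i j, ∀ x ∈ l i j, lieForm x x = 0

/-- The Laplace transform `𝓛_A`. -/
def laplaceA (l : SubspaceNet) : SubspaceNet := fun i j =>
  (l i j ⊔ l (i + 1) j) ⊓ (l i (j + 1) ⊔ l (i + 1) (j + 1))

/-- The Laplace transform `𝓛_B`. -/
def laplaceB (l : SubspaceNet) : SubspaceNet := fun i j =>
  (l i j ⊔ l i (j + 1)) ⊓ (l (i + 1) j ⊔ l (i + 1) (j + 1))

/-- `𝓛_A^m l` is Laplace degenerate: `𝓛_A^m l (i, j)` does not depend on `j`. -/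
def LaplaceDegenerateA (m : ℕ) (l : SubspaceNet) : Prop :=
  ∀ i j j', laplaceA^[m] l i j = laplaceA^[m] l i j'

/-- `𝓛_B^m l` is Laplace degenerate: `𝓛_B^m l (i, j)` does not depend on `i`. -/
def LaplaceDegenerateB (m : ℕ) (l : SubspaceNet) : Prop :=
  ∀ i i' j, laplaceB^[m] l i j = laplaceB^[m] l i' j

/-- The join of the lines `l i j`, `i ∈ ℤ`. -/
def rowSpan (l : SubspaceNet) (j : ℤ) : Submodule ℝ (Fin 6 → ℝ) := ⨆ i, l i j

/-- The join of the lines `l i j`, `j ∈ ℤ`. -/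
def colSpan (l : SubspaceNet) (i : ℤ) : Submodule ℝ (Fin 6 → ℝ) := ⨆ j, l i j

/-- The intersection of the planes `l i j ∨ l i (j + 1)`, `i ∈ ℤ`. -/
def rowMeet (l : SubspaceNet) (j : ℤ) : Submodule ℝ (Fin 6 → ℝ) := ⨅ i, l i j ⊔ l i (j + 1)

/-- The intersection of the planes `l i j ∨ l (i + 1) j`, `j ∈ ℤ`. -/
def colMeet (l : SubspaceNet) (i : ℤ) : Submodule ℝ (Fin 6 → ℝ) := ⨅ j, l i j ⊔ l (i + 1) j

/-- Two families of spherical parameter lines: every parameter line spans a `4`-dimensional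
projective space, and each of the two kinds of intersections of planes is a point. -/
structure HasTwoSphericalFamilies (l : SubspaceNet) : Prop where
  row_spherical : ∀ j, Module.finrank ℝ (rowSpan l j) = 5
  row_concurrent : ∀ j, Module.finrank ℝ (rowMeet l j) = 1
  col_spherical : ∀ i, Module.finrank ℝ (colSpan l i) = 5
  col_concurrent : ∀ i, Module.finrank ℝ (colMeet l i) = 1

/-- The vector `P + e₀ + |P|² e_∞`, where `e_∞ = (e₅ + e₄) / 2` and `e₀ = (e₅ - e₄) / 2`, that
represents a point `P` of Euclidean space in the Lie quadric. -/
noncomputable def liftPoint (P : EuclideanSpace ℝ (Fin 3)) : Fin 6 → ℝ :=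
  ![P 0, P 1, P 2, (‖P‖ ^ 2 - 1) / 2, (‖P‖ ^ 2 + 1) / 2, 0]

/-- `P` is the net of points in Euclidean space that corresponds to the net `l` of contact elements:
the intersection of `l i j` with the polar hyperplane of `[e₆]` represents `P i j`. -/
def IsPointNetOf (l : SubspaceNet) (P : ℤ → ℤ → EuclideanSpace ℝ (Fin 3)) : Prop :=
  ∀ i j, l i j ⊓ lieForm.orthogonal (Submodule.span ℝ {Pi.single 5 1}) =
    Submodule.span ℝ {liftPoint (P i j)}

/-- The set of all complex points of a sphere in Euclidean space. -/
def complexSphere (S : EuclideanGeometry.Sphere (EuclideanSpace ℝ (Fin 3))) : Set (Fin 3 → ℂ) :=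
  {z | ∑ k, (z k - (S.center k : ℂ)) ^ 2 = (S.radius : ℂ) ^ 2}

/-- The spheres have exactly two common (real or imaginary) points, which are distinct unless all
spheres are tangent to one line at a common point. -/
def HaveTwoCommonPoints
    (S : ℤ → EuclideanGeometry.Sphere (EuclideanSpace ℝ (Fin 3))) : Prop :=
  ∃ z w : Fin 3 → ℂ, (⋂ k, complexSphere (S k)) = {z, w} ∧
    (z = w → ∃ x v : EuclideanSpace ℝ (Fin 3), v ≠ 0 ∧
      ∀ k, x ∈ S k ∧ inner ℝ v (x - (S k).center) = 0)

/-- Two planes in Euclidean space are orthogonal: their normals are orthogonal. -/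
def OrthogonalPlanes (E F : AffineSubspace ℝ (EuclideanSpace ℝ (Fin 3))) : Prop :=
  Module.finrank ℝ E.direction = 2 ∧ Module.finrank ℝ F.direction = 2 ∧
    E.directionᗮ ⟂ F.directionᗮ

/-! Totally isotropic subspaces of `ℝ^{4,2}` have dimension at most two, so the plane spanned by two
meeting contact elements is not totally isotropic. A point of this plane off both lines is therefore
off the quadric, and the reflection in its polar hyperplane exchanges the lines
(`isLieSwap_of_mem_sup`). Thus `O_j` reflects the row `j` to the row `j + 1`, and `O'_i` the column
`i` to the column `i + 1`.

Around an elementary quadrilateral the four reflections map `l i j` to itself. Each moves vectors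
only along `O_j` or `O'_i`, which are independent modulo `l i j`, so every vector of `l i j` returns
to itself; the two reflections then commute on `l i j`, which forces `O_j ⟂ O'_i`
(`lieForm_eq_zero_of_closing`). A row lies in the join of one of its lines with all `O'_i`. Since it
spans dimension five, the `O'_i` span at least dimension three, and so do the `O_j`. Being
orthogonal in `ℝ⁶`, the two spans have dimension exactly three and are polar to each other: they are
`X` and `Y`. Moreover `𝓛_A² l (i, j)` is the join of `O'_i` and `O'_{i+1}`, whatever `j` is.

For the Euclidean part, `X` meets the space of vectors representing Euclidean planes, and being
conjugate to such a vector puts the centres of all `H j` in that plane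
(`exists_normal_of_conjugate`). The normals obtained from `X` and `Y` are orthogonal because `X` and
`Y` are conjugate. If the centres are not collinear, `X` also yields a point of equal power with
respect to all spheres; the common points lie on the normal through it and solve one quadratic
equation (`haveTwoCommonPoints_of_conjugate`). -/

/-! ### The Lie form and its isotropic subspaces -/

theorem lieForm_apply (x y : Fin 6 → ℝ) : lieForm x y =
    x 0 * y 0 + x 1 * y 1 + x 2 * y 2 + x 3 * y 3 - x 4 * y 4 - x 5 * y 5 := by
  simp [lieForm, Matrix.toBilin'_apply, Matrix.diagonal_apply, Fin.sum_univ_six]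
  ring

theorem lieForm_comm (x y : Fin 6 → ℝ) : lieForm x y = lieForm y x := by
  simp only [lieForm_apply]; ring

theorem lieForm_nondegenerate : lieForm.Nondegenerate := by
  refine LinearMap.BilinForm.nondegenerate_toBilin'_of_det_ne_zero' _ ?_
  simp [Matrix.det_diagonal, Fin.prod_univ_six]

theorem mem_lieForm_orthogonal {S : Submodule ℝ (Fin 6 → ℝ)} {x : Fin 6 → ℝ} :
    x ∈ lieForm.orthogonal S ↔ ∀ y ∈ S, lieForm y x = 0 := Iff.rfl

theorem finrank_lieForm_orthogonal (S : Submodule ℝ (Fin 6 → ℝ)) :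
    Module.finrank ℝ (lieForm.orthogonal S) = 6 - Module.finrank ℝ S := by
  have := LinearMap.BilinForm.finrank_orthogonal lieForm_nondegenerate S
  simpa using this

theorem lieForm_eq_zero_of_isotropic {L : Submodule ℝ (Fin 6 → ℝ)}
    (hL : ∀ x ∈ L, lieForm x x = 0) {x y : Fin 6 → ℝ} (hx : x ∈ L) (hy : y ∈ L) :
    lieForm x y = 0 := by
  have h := hL _ (L.add_mem hx hy)
  simp only [map_add, LinearMap.add_apply, hL x hx, hL y hy, lieForm_comm y x] at h
  linarith

/-- The isotropic subspaces of `ℝ^{4,2}` have dimension at most two. -/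
theorem finrank_le_two_of_isotropic {L : Submodule ℝ (Fin 6 → ℝ)}
    (hL : ∀ x ∈ L, lieForm x x = 0) : Module.finrank ℝ L ≤ 2 := by
  let f : (Fin 6 → ℝ) →ₗ[ℝ] (Fin 2 → ℝ) :=
    LinearMap.pi ![LinearMap.proj 4, LinearMap.proj 5]
  -- The form is positive definite on the kernel of `f`, so an isotropic subspace meets it
  -- trivially.
  have hf : Function.Injective (f.comp L.subtype) := by
    rw [← LinearMap.ker_eq_bot, LinearMap.ker_eq_bot']
    rintro ⟨x, hx⟩ h
    have h4 : x 4 = 0 := congrFun h 0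
    have h5 : x 5 = 0 := congrFun h 1
    have h0 := hL x hx
    rw [lieForm_apply, h4, h5] at h0
    ext k
    have : x 0 = 0 ∧ x 1 = 0 ∧ x 2 = 0 ∧ x 3 = 0 := by
      refine ⟨?_, ?_, ?_, ?_⟩ <;> nlinarith [sq_nonneg (x 0), sq_nonneg (x 1), sq_nonneg (x 2),
        sq_nonneg (x 3)]
    fin_cases k <;> simp [this, h4, h5]
  simpa using LinearMap.finrank_le_finrank_of_injective hf

/-! ### Reflections that exchange contact elements -/

/-- The reflection in the polar hyperplane of `o`. -/
noncomputable def lieReflection (o x : Fin 6 → ℝ) : Fin 6 → ℝ :=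
  x - (2 * lieForm x o / lieForm o o) • o

theorem lieReflection_lieReflection {o : Fin 6 → ℝ} (ho : lieForm o o ≠ 0) (x : Fin 6 → ℝ) :
    lieReflection o (lieReflection o x) = x := by
  simp only [lieReflection, map_sub, map_smul, LinearMap.sub_apply, LinearMap.smul_apply,
    smul_eq_mul, sub_sub, ← add_smul]
  rw [sub_eq_self]
  convert zero_smul ℝ o
  field_simp
  ring

theorem lieReflection_mem {S : Submodule ℝ (Fin 6 → ℝ)} {o x : Fin 6 → ℝ} (ho : o ∈ S)
    (hx : x ∈ S) : lieReflection o x ∈ S :=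
  S.sub_mem hx (S.smul_mem _ ho)

theorem lieReflection_smul (c : ℝ) (hc : c ≠ 0) (o x : Fin 6 → ℝ) :
    lieReflection (c • o) x = lieReflection o x := by
  simp only [lieReflection, map_smul, LinearMap.smul_apply, smul_eq_mul, smul_smul]
  congr 2
  field_simp

/-- The reflection in the polar hyperplane of `o` interchanges `L` and `M`. -/
structure IsLieSwap (o : Fin 6 → ℝ) (L M : Submodule ℝ (Fin 6 → ℝ)) : Prop where
  ne_zero : lieForm o o ≠ 0
  exists_ne_zero : ∃ x ∈ L, lieForm x o ≠ 0
  map_left : ∀ x ∈ L, lieReflection o x ∈ M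
  map_right : ∀ x ∈ M, lieReflection o x ∈ L

theorem sup_span_singleton_eq {V : Type*} [AddCommGroup V] [Module ℝ V] [FiniteDimensional ℝ V]
    {K L : Submodule ℝ V} (hKL : K ≤ L) {u : V} (hu : u ∈ L) (huK : u ∉ K)
    (h : Module.finrank ℝ L = Module.finrank ℝ K + 1) : K ⊔ Submodule.span ℝ {u} = L := by
  have hle : K ⊔ Submodule.span ℝ {u} ≤ L :=
    sup_le hKL ((Submodule.span_singleton_le_iff_mem _ _).2 hu)
  refine Submodule.eq_of_le_of_finrank_le hle ?_
  rw [h]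
  refine Submodule.finrank_lt_finrank_of_lt (lt_of_le_of_ne le_sup_left fun he => huK ?_)
  rw [he]
  exact Submodule.mem_sup_right (Submodule.mem_span_singleton_self u)

/-- With `o = u + v`, `u ∈ L`, `v ∈ M`, the reflection fixes `L ⊓ M` and sends `u` to `-v`. -/
theorem isLieSwap_of_mem_sup {L M : Submodule ℝ (Fin 6 → ℝ)} (hL : Module.finrank ℝ L = 2)
    (hM : Module.finrank ℝ M = 2) (hLM : Module.finrank ℝ ↥(L ⊓ M) = 1)
    (iL : ∀ x ∈ L, lieForm x x = 0) (iM : ∀ x ∈ M, lieForm x x = 0)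
    {o : Fin 6 → ℝ} (ho : o ∈ L ⊔ M) (hoL : o ∉ L) (hoM : o ∉ M) : IsLieSwap o L M := by
  obtain ⟨u, hu, v, hv, rfl⟩ := Submodule.mem_sup.1 ho
  have huM : u ∉ L ⊓ M := fun h => hoM (M.add_mem h.2 hv)
  have hvL : v ∉ L ⊓ M := fun h => hoL (L.add_mem hu h.1)
  have eL := sup_span_singleton_eq inf_le_left hu huM (by rw [hL, hLM])
  have eM := sup_span_singleton_eq inf_le_right hv hvL (by rw [hM, hLM])
  -- Otherwise all of `L ⊔ M`, of dimension three, would be isotropic.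
  have huv : lieForm u v ≠ 0 := by
    intro h0
    have h3 : Module.finrank ℝ ↥(L ⊔ M) = 3 := by
      have := Submodule.finrank_sup_add_finrank_inf_eq L M
      omega
    have : ∀ x ∈ L ⊔ M, lieForm x x = 0 := by
      intro x hx
      obtain ⟨a, ha, b, hb, rfl⟩ := Submodule.mem_sup.1 hx
      have hab : lieForm a b = 0 := by
        rw [← eL] at ha
        rw [← eM] at hb
        obtain ⟨m, hm, a', ha', rfl⟩ := Submodule.mem_sup.1 ha
        obtain ⟨n, hn, b', hb', rfl⟩ := Submodule.mem_sup.1 hb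
        obtain ⟨s, rfl⟩ := Submodule.mem_span_singleton.1 ha'
        obtain ⟨t, rfl⟩ := Submodule.mem_span_singleton.1 hb'
        have h1 := lieForm_eq_zero_of_isotropic iL hm.1 hn.1
        have h2 := lieForm_eq_zero_of_isotropic iM hm.2 hv
        have h3 := lieForm_eq_zero_of_isotropic iL hu hn.1
        simp [h1, h2, h3, h0]
      simp [iL a ha, iM b hb, hab, lieForm_comm b a]
    have := finrank_le_two_of_isotropic this
    omega
  have huu := iL u hu
  have hvv := iM v hv
  have hvu : lieForm v u = lieForm u v := lieForm_comm v u
  have hoo : lieForm (u + v) (u + v) = 2 * lieForm u v := by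
    simp [huu, hvv, hvu]; ring
  have hne : lieForm (u + v) (u + v) ≠ 0 := by rw [hoo]; simpa using huv
  have ru (m : Fin 6 → ℝ) (hm : m ∈ L ⊓ M) (s : ℝ) :
      lieReflection (u + v) (m + s • u) = m + (-s) • v := by
    have h2 := lieForm_eq_zero_of_isotropic iM hm.2 hv
    have h3 := lieForm_eq_zero_of_isotropic iL hm.1 hu
    have : 2 * lieForm (m + s • u) (u + v) / lieForm (u + v) (u + v) = s := by
      rw [hoo]; simp [h2, h3, huu]; field_simp
    rw [lieReflection, this]
    module
  have rv (m : Fin 6 → ℝ) (hm : m ∈ L ⊓ M) (s : ℝ) :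
      lieReflection (u + v) (m + s • v) = m + (-s) • u := by
    have := ru m hm (-s)
    rw [neg_neg] at this
    rw [← this, lieReflection_lieReflection hne]
  refine ⟨hne, ⟨u, hu, by simpa [huu] using huv⟩, fun x hx => ?_, fun x hx => ?_⟩
  · rw [← eL] at hx
    obtain ⟨m, hm, a, ha, rfl⟩ := Submodule.mem_sup.1 hx
    obtain ⟨s, rfl⟩ := Submodule.mem_span_singleton.1 ha
    rw [ru m hm]
    exact M.add_mem hm.2 (M.smul_mem _ hv)
  · rw [← eM] at hx
    obtain ⟨m, hm, a, ha, rfl⟩ := Submodule.mem_sup.1 hx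
    obtain ⟨s, rfl⟩ := Submodule.mem_span_singleton.1 ha
    rw [rv m hm]
    exact L.add_mem hm.1 (L.smul_mem _ hu)

/-- If the four reflected lines close up, then the centres of the reflections are conjugate. -/
theorem lieForm_eq_zero_of_closing {L₀₀ L₁₀ L₀₁ L₁₁ : Submodule ℝ (Fin 6 → ℝ)}
    {o o' : Fin 6 → ℝ} (h₀ : IsLieSwap o L₀₀ L₀₁) (h₁ : IsLieSwap o L₁₀ L₁₁)
    (h₀' : IsLieSwap o' L₀₀ L₁₀) (h₁' : IsLieSwap o' L₀₁ L₁₁)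
    (ho : o ∉ L₀₀ ⊔ Submodule.span ℝ {o'}) (ho' : o' ∉ L₀₀) : lieForm o o' = 0 := by
  obtain ⟨x, hx, hxo⟩ := h₀.exists_ne_zero
  set r := lieReflection o with hr
  set r' := lieReflection o' with hr'
  have hz : r' (r (r' (r x))) ∈ L₀₀ :=
    h₀'.map_right _ (h₁.map_right _ (h₁'.map_left _ (h₀.map_left _ hx)))
  have hspan (y : Fin 6 → ℝ) : ∃ s, r y = y - s • o := ⟨_, rfl⟩
  have hspan' (y : Fin 6 → ℝ) : ∃ s, r' y = y - s • o' := ⟨_, rfl⟩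
  have hindep (s t : ℝ) (h : s • o + t • o' ∈ L₀₀) : s = 0 ∧ t = 0 := by
    have hs : s = 0 := by
      by_contra hs
      apply ho
      have : s • o ∈ L₀₀ ⊔ Submodule.span ℝ {o'} := by
        rw [show s • o = (s • o + t • o') + (-t) • o' by module]
        exact add_mem (Submodule.mem_sup_left h)
          (Submodule.mem_sup_right (Submodule.smul_mem _ _ (Submodule.mem_span_singleton_self _)))
      exact (Submodule.smul_mem_iff _ hs).1 this
    refine ⟨hs, ?_⟩
    by_contra ht
    rw [hs, zero_smul, zero_add] at h
    exact ho' ((Submodule.smul_mem_iff _ ht).1 h)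
  -- The displacement is a combination of `o` and `o'` that lies in `L₀₀`, hence zero.
  have hfix : r' (r (r' (r x))) = x := by
    obtain ⟨a, ha⟩ := hspan x
    obtain ⟨b, hb⟩ := hspan' (r x)
    obtain ⟨c, hc⟩ := hspan (r' (r x))
    obtain ⟨d, hd⟩ := hspan' (r (r' (r x)))
    have e : r' (r (r' (r x))) - x = (-a - c) • o + (-b - d) • o' := by
      rw [hd, hc, hb, ha]; module
    have hm := L₀₀.sub_mem hz hx
    rw [e] at hm
    obtain ⟨h1, h2⟩ := hindep _ _ hm
    rw [← sub_eq_zero, e, h1, h2]; simp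
  have hcomm : r' (r x) = r (r' x) := by
    rw [← lieReflection_lieReflection h₀.ne_zero (r' (r x)),
      ← lieReflection_lieReflection h₀'.ne_zero (lieReflection o (r' (r x)))]
    exact congrArg (fun y => r (r' y)) hfix
  -- The coefficient of `o'` is a nonzero multiple of `lieForm x o * lieForm o o'`.
  have key : r' (r x) - r (r' x) =
      (-(2 * lieForm x o' / lieForm o' o') * (2 * lieForm o' o / lieForm o o)) • o +
      ((2 * lieForm x o / lieForm o o) * (2 * lieForm o o' / lieForm o' o')) • o' := by
    simp only [hr, hr', lieReflection, map_sub, map_smul, LinearMap.sub_apply,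
      LinearMap.smul_apply, smul_eq_mul]
    module
  rw [hcomm, sub_self] at key
  have h2 := (hindep _ _ (key ▸ L₀₀.zero_mem)).2
  have n1 := h₀.ne_zero
  have n2 := h₀'.ne_zero
  simpa [hxo, n1, n2] using h2

/-! ### Centres of the reflections of a net -/

theorem IsPrincipalContactElementNet.swap {l : SubspaceNet}
    (hl : IsPrincipalContactElementNet l) :
    IsPrincipalContactElementNet (fun i j => l j i) :=
  ⟨⟨fun i j => hl.1.1 j i, fun i j => hl.1.3 j i, fun i j => hl.1.2 j i⟩, fun i j => hl.2 j i⟩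

theorem IsDiscreteLineCongruence.swap {l : SubspaceNet} (hl : IsDiscreteLineCongruence l) :
    IsDiscreteLineCongruence (fun i j => l j i) :=
  ⟨fun i j => hl.1 j i, fun i j => hl.3 j i, fun i j => hl.2 j i⟩

theorem IsDiscreteLineCongruence.finrank_sup {l : SubspaceNet} (hl : IsDiscreteLineCongruence l)
    (i j : ℤ) : Module.finrank ℝ ↥(l i j ⊔ l (i + 1) j) = 3 := by
  have h := Submodule.finrank_sup_add_finrank_inf_eq (l i j) (l (i + 1) j)
  rw [hl.1, hl.1, hl.2] at h
  omega

/-- The points `o j` that span the intersections `rowMeet l j` are the centres of reflections that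
map each parameter line to the next one. -/
theorem exists_row_centres {l : SubspaceNet} (hl : IsPrincipalContactElementNet l)
    (hc : ∀ j, Module.finrank ℝ (rowMeet l j) = 1)
    (hrow : ∀ i j, ¬ rowMeet l j ≤ l i j ∧ ¬ rowMeet l j ≤ l i (j + 1)) :
    ∃ o : ℤ → Fin 6 → ℝ, ∀ i j, o j ∈ l i j ⊔ l i (j + 1) ∧ o j ∉ l i j ∧
      IsLieSwap (o j) (l i j) (l i (j + 1)) := by
  choose o ho using fun j => finrank_eq_one_iff'.1 (hc j)
  have hspan (j : ℤ) (S : Submodule ℝ (Fin 6 → ℝ)) (h : (o j : Fin 6 → ℝ) ∈ S) :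
      rowMeet l j ≤ S := by
    intro x hx
    obtain ⟨c, hc⟩ := (ho j).2 ⟨x, hx⟩
    have : c • (o j : Fin 6 → ℝ) = x := congrArg Subtype.val hc
    exact this ▸ S.smul_mem c h
  refine ⟨fun j => o j, fun i j => ?_⟩
  have hmem : (o j : Fin 6 → ℝ) ∈ l i j ⊔ l i (j + 1) := (Submodule.mem_iInf _).1 (o j).2 i
  have h1 : (o j : Fin 6 → ℝ) ∉ l i j := fun h => (hrow i j).1 (hspan _ _ h)
  have h2 : (o j : Fin 6 → ℝ) ∉ l i (j + 1) := fun h => (hrow i j).2 (hspan _ _ h)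
  exact ⟨hmem, h1, isLieSwap_of_mem_sup (hl.1.1 _ _) (hl.1.1 _ _) (hl.1.3 _ _) (hl.2 _ _)
    (hl.2 _ _) hmem h1 h2⟩

/-- The centres of the reflections in the two directions of the net are conjugate. -/
theorem lieForm_centres_eq_zero {l : SubspaceNet} (hl : IsPrincipalContactElementNet l)
    (hA : IsLineNet (laplaceA l)) {o o' : ℤ → Fin 6 → ℝ}
    (ho : ∀ i j, o j ∈ l i j ⊔ l i (j + 1) ∧ o j ∉ l i j ∧ IsLieSwap (o j) (l i j) (l i (j + 1)))
    (ho' : ∀ i j, o' i ∈ l i j ⊔ l (i + 1) j ∧ o' i ∉ l i j ∧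
      IsLieSwap (o' i) (l i j) (l (i + 1) j)) (i j : ℤ) :
    lieForm (o j) (o' i) = 0 := by
  refine lieForm_eq_zero_of_closing (ho i j).2.2 (ho (i + 1) j).2.2 (ho' i j).2.2
    (ho' i (j + 1)).2.2 (fun h => ?_) (ho' i j).2.1
  have hoA : o j ∈ l i j ⊔ l (i + 1) j :=
    sup_le le_sup_left ((Submodule.span_singleton_le_iff_mem _ _).2 (ho' i j).1) h
  -- If `o j` lay in the plane `l i j ⊔ l (i + 1) j`, its reflection would preserve that plane. The
  -- two planes that define `laplaceA l i j` would coincide, and their meet would not be a line.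
  have hle : l i (j + 1) ⊔ l (i + 1) (j + 1) ≤ l i j ⊔ l (i + 1) j := by
    have (k : ℤ) (hk : l k j ≤ l i j ⊔ l (i + 1) j) : l k (j + 1) ≤ l i j ⊔ l (i + 1) j := by
      intro x hx
      rw [← lieReflection_lieReflection (ho k j).2.2.ne_zero x]
      exact lieReflection_mem hoA (hk ((ho k j).2.2.map_right x hx))
    exact sup_le (this _ le_sup_left) (this _ le_sup_right)
  have h2 := hA i j
  rw [laplaceA, inf_eq_right.2 hle, hl.1.finrank_sup] at h2
  omega

/-- Passing from one line of a row to the next, in either direction, changes a vector only by a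
multiple of some `o' i`. -/
theorem le_sup_span_centres {l : SubspaceNet} {o' : ℤ → Fin 6 → ℝ}
    (ho' : ∀ i j, IsLieSwap (o' i) (l i j) (l (i + 1) j)) (i j : ℤ) :
    l i j ≤ l 0 j ⊔ Submodule.span ℝ (Set.range o') := by
  have hmem (i : ℤ) : o' i ∈ l 0 j ⊔ Submodule.span ℝ (Set.range o') :=
    Submodule.mem_sup_right (Submodule.subset_span ⟨i, rfl⟩)
  induction i using Int.induction_on with
  | zero => exact le_sup_left
  | succ i ih =>
    intro x hx
    rw [← lieReflection_lieReflection (ho' i j).ne_zero x]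
    exact lieReflection_mem (hmem _) (ih ((ho' i j).map_right x hx))
  | pred i ih =>
    intro x hx
    have h := ho' (-(i : ℤ) - 1) j
    rw [sub_add_cancel] at h
    rw [← lieReflection_lieReflection h.ne_zero x]
    exact lieReflection_mem (hmem _) (ih (h.map_left x hx))

theorem three_le_finrank_span_centres {l : SubspaceNet} (hl : IsLineNet l)
    (hs : Module.finrank ℝ (rowSpan l 0) = 5) {o' : ℤ → Fin 6 → ℝ}
    (ho' : ∀ i j, IsLieSwap (o' i) (l i j) (l (i + 1) j)) :
    3 ≤ Module.finrank ℝ (Submodule.span ℝ (Set.range o')) := by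
  have h : rowSpan l 0 ≤ l 0 0 ⊔ Submodule.span ℝ (Set.range o') :=
    iSup_le fun i => le_sup_span_centres ho' i 0
  have h1 := Submodule.finrank_mono h
  have h2 := Submodule.finrank_add_le_finrank_add_finrank (l 0 0)
    (Submodule.span ℝ (Set.range o'))
  have := hl 0 0
  omega

theorem span_centres_eq_orthogonal {U U' : Submodule ℝ (Fin 6 → ℝ)}
    (h : 3 ≤ Module.finrank ℝ U) (h' : 3 ≤ Module.finrank ℝ U')
    (hU : U ≤ lieForm.orthogonal U') :
    Module.finrank ℝ U = 3 ∧ Module.finrank ℝ U' = 3 ∧ U = lieForm.orthogonal U' := by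
  have h1 := Submodule.finrank_mono hU
  have h2 := finrank_lieForm_orthogonal U'
  have h3 : Module.finrank ℝ U' ≤ 6 := by simpa using Submodule.finrank_le U'
  exact ⟨by omega, by omega, Submodule.eq_of_le_of_finrank_eq hU (by omega)⟩

theorem span_le_orthogonal_span {s t : Set (Fin 6 → ℝ)}
    (h : ∀ x ∈ s, ∀ y ∈ t, lieForm x y = 0) :
    Submodule.span ℝ s ≤ lieForm.orthogonal (Submodule.span ℝ t) := by
  refine Submodule.span_le.2 fun x hx => mem_lieForm_orthogonal.2 fun y hy => ?_
  induction hy using Submodule.span_induction with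
  | mem y hy => rw [lieForm_comm]; exact h x hx y hy
  | zero => simp
  | add y z _ _ hy hz => simp [hy, hz]
  | smul c y _ hy => simp [hy]

/-- The second Laplace transform is the join of the centres of two consecutive reflections. -/
theorem laplaceDegenerateA_two {l : SubspaceNet}
    (hA : IsDiscreteLineCongruence (laplaceA l)) (hA2 : IsLineNet (laplaceA^[2] l))
    {o' : ℤ → Fin 6 → ℝ} (ho' : ∀ i j, o' i ∈ l i j ⊔ l (i + 1) j ∧ o' i ∉ l i j ∧
      IsLieSwap (o' i) (l i j) (l (i + 1) j)) :
    LaplaceDegenerateA 2 l := by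
  have hmem (i j : ℤ) : o' i ∈ laplaceA l i j := ⟨(ho' i j).1, (ho' i (j + 1)).1⟩
  have hle (i j : ℤ) : Submodule.span ℝ {o' i, o' (i + 1)} ≤ laplaceA^[2] l i j := by
    rw [Submodule.span_le]
    have h (j : ℤ) : ({o' i, o' (i + 1)} : Set (Fin 6 → ℝ)) ⊆
        (laplaceA l i j ⊔ laplaceA l (i + 1) j : Submodule ℝ (Fin 6 → ℝ)) := by
      rintro x (rfl | rfl)
      · exact Submodule.mem_sup_left (hmem _ _)
      · exact Submodule.mem_sup_right (hmem _ _)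
    exact fun x hx => ⟨h j hx, h (j + 1) hx⟩
  have hne (i : ℤ) : o' i ≠ 0 := fun h => (ho' i 0).2.1 (h ▸ zero_mem _)
  have hli (i : ℤ) : LinearIndependent ℝ ![o' i, o' (i + 1)] := by
    rw [LinearIndependent.pair_iff' (hne i)]
    intro a ha
    have ha0 : a ≠ 0 := by
      rintro rfl
      exact hne (i + 1) (by rw [← ha, zero_smul])
    -- Proportional centres define the same reflection, so applying it twice brings `l (i + 1 + 1)
    -- j` back to `l i j`. Then neighbouring lines of `laplaceA l` coincide, although they should
    -- meet in one point.
    have hll (j : ℤ) : l (i + 1 + 1) j ≤ l i j := by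
      intro x hx
      have hx' := (ho' (i + 1) j).2.2.map_right x hx
      rw [← ha, lieReflection_smul a ha0] at hx'
      rw [← lieReflection_lieReflection (ho' i j).2.2.ne_zero x]
      exact (ho' i j).2.2.map_right _ hx'
    have hLA : laplaceA l (i + 1) 0 ≤ laplaceA l i 0 :=
      inf_le_inf (sup_le le_sup_right ((hll _).trans le_sup_left))
        (sup_le le_sup_right ((hll _).trans le_sup_left))
    have h1 := hA.2 i 0
    rw [inf_eq_right.2 hLA, hA.1] at h1
    omega
  have heq (i j : ℤ) : Submodule.span ℝ {o' i, o' (i + 1)} = laplaceA^[2] l i j := by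
    refine Submodule.eq_of_le_of_finrank_eq (hle i j) ?_
    rw [hA2 i j]
    have := finrank_span_eq_card (hli i)
    rwa [Matrix.range_cons_cons_empty, Fintype.card_fin] at this
  intro i j j'
  rw [← heq, ← heq]

/-! ### Euclidean planes and spheres in Lie coordinates -/

theorem vectorSpan_le_orthogonal_span {V : Type*} [NormedAddCommGroup V] [InnerProductSpace ℝ V]
    {s t : Set V} (h : ∀ v ∈ t, ∃ μ, ∀ x ∈ s, inner ℝ v x = μ) :
    vectorSpan ℝ s ≤ (Submodule.span ℝ t)ᗮ := by
  rw [vectorSpan, Submodule.span_le]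
  rintro _ ⟨x, hx, y, hy, rfl⟩
  rw [SetLike.mem_coe, Submodule.mem_orthogonal]
  intro u hu
  induction hu using Submodule.span_induction with
  | mem v hv =>
    obtain ⟨μ, hμ⟩ := h v hv
    change inner ℝ v (x - y) = 0
    rw [inner_sub_right, hμ x hx, hμ y hy, sub_self]
  | zero => simp
  | add a b _ _ ha hb => rw [inner_add_left, ha, hb, add_zero]
  | smul c a _ ha => rw [inner_smul_left, ha, mul_zero]

theorem finrank_orthogonal_euclidean_three (K : Submodule ℝ (EuclideanSpace ℝ (Fin 3))) :
    Module.finrank ℝ Kᗮ = 3 - Module.finrank ℝ K := by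
  have := K.finrank_add_finrank_orthogonal
  rw [finrank_euclideanSpace_fin] at this
  omega

theorem coplanar_of_inner_eq {s : Set (EuclideanSpace ℝ (Fin 3))}
    {v : EuclideanSpace ℝ (Fin 3)} (hv : v ≠ 0) {μ : ℝ} (h : ∀ x ∈ s, inner ℝ v x = μ) :
    Coplanar ℝ s := by
  rw [Coplanar, ← Module.finrank_eq_rank]
  have h1 := Submodule.finrank_mono (vectorSpan_le_orthogonal_span (s := s) (t := {v})
    (by rintro _ rfl; exact ⟨μ, h⟩))
  rw [finrank_orthogonal_euclidean_three, finrank_span_singleton hv] at h1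
  exact_mod_cast h1

theorem collinear_of_inner_eq {s : Set (EuclideanSpace ℝ (Fin 3))}
    {v w : EuclideanSpace ℝ (Fin 3)} (hvw : LinearIndependent ℝ ![v, w]) {μ ν : ℝ}
    (hv : ∀ x ∈ s, inner ℝ v x = μ) (hw : ∀ x ∈ s, inner ℝ w x = ν) : Collinear ℝ s := by
  rw [collinear_iff_rank_le_one, ← Module.finrank_eq_rank]
  have h1 := Submodule.finrank_mono (vectorSpan_le_orthogonal_span (s := s) (t := {v, w})
    (by rintro _ (rfl | rfl); exacts [⟨μ, hv⟩, ⟨ν, hw⟩]))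
  have h2 := finrank_span_eq_card hvw
  rw [Matrix.range_cons_cons_empty, Fintype.card_fin] at h2
  rw [finrank_orthogonal_euclidean_three, h2] at h1
  exact_mod_cast h1

theorem inner_euclidean_three (x y : EuclideanSpace ℝ (Fin 3)) :
    inner ℝ x y = x 0 * y 0 + x 1 * y 1 + x 2 * y 2 := by
  simp [PiLp.inner_apply, Fin.sum_univ_three]; ring

theorem norm_sq_euclidean_three (x : EuclideanSpace ℝ (Fin 3)) :
    ‖x‖ ^ 2 = x 0 ^ 2 + x 1 ^ 2 + x 2 ^ 2 := by
  simp [EuclideanSpace.norm_sq_eq, Fin.sum_univ_three]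

/-- The vector `c + e₀ + τ e_∞ + f e₆`; it represents the sphere with centre `c` and radius `|f|`
if `τ = |c|² - f²`. -/
noncomputable def pencilVector (c : EuclideanSpace ℝ (Fin 3)) (τ f : ℝ) : Fin 6 → ℝ :=
  ![c 0, c 1, c 2, (τ - 1) / 2, (τ + 1) / 2, f]

theorem pencilVector_smul_eq {p : Fin 6 → ℝ} (hp : p 4 - p 3 ≠ 0) :
    (p 4 - p 3) • pencilVector ((p 4 - p 3)⁻¹ • !₂[p 0, p 1, p 2])
      ((p 3 + p 4) / (p 4 - p 3)) (p 5 / (p 4 - p 3)) = p := by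
  ext k
  fin_cases k <;> simp [pencilVector] <;> field_simp <;> ring

theorem lieForm_pencilVector (c x : EuclideanSpace ℝ (Fin 3)) (ρ τ f : ℝ) :
    lieForm (pencilVector c ρ f) (pencilVector x τ 0) = inner ℝ c x - (ρ + τ) / 2 := by
  rw [lieForm_apply, inner_euclidean_three]
  simp [pencilVector]
  ring

theorem liftPoint_eq (P : EuclideanSpace ℝ (Fin 3)) : liftPoint P = pencilVector P (‖P‖ ^ 2) 0 :=
  rfl

/-- A lifted point has last coordinate zero, so `f` drops out. The polar hyperplane of any such
vector, on the quadric or not, selects the points at squared distance `‖c‖ ^ 2 - ρ` from `c`. -/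
theorem lieForm_liftPoint (P c : EuclideanSpace ℝ (Fin 3)) (ρ f : ℝ) :
    lieForm (pencilVector c ρ f) (liftPoint P) = (‖c‖ ^ 2 - ρ - dist P c ^ 2) / 2 := by
  rw [liftPoint_eq, lieForm_pencilVector, dist_eq_norm, norm_sub_sq_real, real_inner_comm]
  ring

theorem EuclideanGeometry.Sphere.eq_of_not_coplanar {ι : Type*} [hne : Nonempty ι]
    {Q : ι → EuclideanSpace ℝ (Fin 3)} (hQ : ¬ Coplanar ℝ (Set.range Q))
    {S T : EuclideanGeometry.Sphere (EuclideanSpace ℝ (Fin 3))} (hS : ∀ i, Q i ∈ S)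
    (hT : ∀ i, Q i ∈ T) : S = T := by
  have hc : S.center = T.center := by
    by_contra hc
    refine hQ (coplanar_of_inner_eq (v := S.center - T.center) (sub_ne_zero.2 hc)
      (μ := (‖S.center‖ ^ 2 - S.radius ^ 2 - (‖T.center‖ ^ 2 - T.radius ^ 2)) / 2) ?_)
    rintro _ ⟨i, rfl⟩
    have h1 := EuclideanGeometry.mem_sphere.1 (hS i)
    have h2 := EuclideanGeometry.mem_sphere.1 (hT i)
    rw [← h1, ← h2, dist_eq_norm, dist_eq_norm, norm_sub_sq_real, norm_sub_sq_real,
      inner_sub_left, real_inner_comm, real_inner_comm (Q i)]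
    ring
  obtain ⟨i⟩ := hne
  refine EuclideanGeometry.Sphere.ext hc ?_
  rw [← EuclideanGeometry.mem_sphere.1 (hS i), ← EuclideanGeometry.mem_sphere.1 (hT i), hc]

/-- Non-coplanar points that are represented in the polar hyperplane of `p` lie on exactly one
sphere. -/
theorem exists_sphere_of_lieForm_eq_zero {ι : Type*} [hne : Nonempty ι] {Q : ι → EuclideanSpace ℝ (Fin 3)}
    (hQ : ¬ Coplanar ℝ (Set.range Q)) {p : Fin 6 → ℝ}
    (hp : p ∉ Submodule.span ℝ {(Pi.single 5 1 : Fin 6 → ℝ)})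
    (h : ∀ i, lieForm p (liftPoint (Q i)) = 0) {N : Submodule ℝ (Fin 6 → ℝ)} (hN : p ∈ N) :
    ∃ S : EuclideanGeometry.Sphere (EuclideanSpace ℝ (Fin 3)),
      (∀ T, (∀ i, Q i ∈ T) ↔ T = S) ∧
      ∃ f, pencilVector S.center (‖S.center‖ ^ 2 - S.radius ^ 2) f ∈ N := by
  -- If `p 4 = p 3`, conjugacy to `p` is a linear condition on the points: either it confines them
  -- to a plane, or it is trivial and `p` is a multiple of `e₆`.
  have hd : p 4 - p 3 ≠ 0 := by
    intro hd
    have hd' : p 4 = p 3 := by linarith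
    have hin (i : ι) : inner ℝ !₂[p 0, p 1, p 2] (Q i) = p 3 := by
      have := h i
      rw [lieForm_apply] at this
      simp only [liftPoint, hd'] at this
      rw [inner_euclidean_three]
      simp at this ⊢
      linarith
    by_cases ha : !₂[p 0, p 1, p 2] = (0 : EuclideanSpace ℝ (Fin 3))
    · apply hp
      obtain ⟨i⟩ := hne
      have h3 := hin i
      rw [ha, inner_zero_left] at h3
      have h0 : p 0 = 0 := congrArg (fun x : EuclideanSpace ℝ (Fin 3) => x 0) ha
      have h1 : p 1 = 0 := congrArg (fun x : EuclideanSpace ℝ (Fin 3) => x 1) ha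
      have h2 : p 2 = 0 := congrArg (fun x : EuclideanSpace ℝ (Fin 3) => x 2) ha
      refine Submodule.mem_span_singleton.2 ⟨p 5, ?_⟩
      ext k
      fin_cases k <;> simp [h0, h1, h2, ← h3, hd']
    · refine hQ (coplanar_of_inner_eq ha (μ := p 3) ?_)
      rintro _ ⟨i, rfl⟩
      exact hin i
  set c : EuclideanSpace ℝ (Fin 3) := (p 4 - p 3)⁻¹ • !₂[p 0, p 1, p 2] with hc
  set ρ := (p 3 + p 4) / (p 4 - p 3) with hρ
  set f := p 5 / (p 4 - p 3) with hf
  have hpv : (p 4 - p 3) • pencilVector c ρ f = p := pencilVector_smul_eq hd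
  have hdist (i : ι) : dist (Q i) c ^ 2 = ‖c‖ ^ 2 - ρ := by
    have := h i
    rw [← hpv, map_smul, LinearMap.smul_apply, smul_eq_mul, mul_eq_zero,
      lieForm_liftPoint] at this
    have := this.resolve_left hd
    linarith
  have hmem : pencilVector c ρ f ∈ N := by
    rw [← Submodule.smul_mem_iff _ hd, hpv]
    exact hN
  have hnn : 0 ≤ ‖c‖ ^ 2 - ρ := by
    obtain ⟨i⟩ := hne
    rw [← hdist i]
    positivity
  let S : EuclideanGeometry.Sphere (EuclideanSpace ℝ (Fin 3)) := ⟨c, √(‖c‖ ^ 2 - ρ)⟩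
  have hS (i : ι) : Q i ∈ S := by
    rw [EuclideanGeometry.mem_sphere, ← Real.sqrt_sq dist_nonneg, hdist]
  refine ⟨S, fun T => ⟨fun hT => EuclideanGeometry.Sphere.eq_of_not_coplanar hQ hT hS, ?_⟩, f, ?_⟩
  · rintro rfl
    exact hS
  · rwa [Real.sq_sqrt hnn, sub_sub_cancel]

/-! ### Planes of centres and common points -/

theorem exists_mem_ne_zero_of_finrank_eq_three {V : Type*} [AddCommGroup V] [Module ℝ V]
    {X : Submodule ℝ V} (hX : Module.finrank ℝ X = 3) (φ ψ : V →ₗ[ℝ] ℝ) :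
    ∃ x ∈ X, x ≠ 0 ∧ φ x = 0 ∧ ψ x = 0 := by
  have : FiniteDimensional ℝ X := Module.finite_of_finrank_pos (by omega)
  obtain ⟨x, hx, hx0⟩ := (Submodule.ne_bot_iff _).1 (LinearMap.ker_ne_bot_of_finrank_lt
    (f := (φ.prod ψ).comp X.subtype) (by simp [hX]))
  have h := Prod.ext_iff.1 (LinearMap.mem_ker.1 hx)
  exact ⟨x, x.2, fun h0 => hx0 (Subtype.ext h0), h.1, h.2⟩

theorem lieForm_pencilVector_of_eq {p : Fin 6 → ℝ} (h5 : p 5 = 0) (h3 : p 4 = p 3)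
    (c : EuclideanSpace ℝ (Fin 3)) (ρ f : ℝ) :
    lieForm (pencilVector c ρ f) p = inner ℝ !₂[p 0, p 1, p 2] c - p 3 := by
  rw [lieForm_apply, inner_euclidean_three, h5, h3]
  simp [pencilVector]
  ring

/-- With zero direction, `p` would be a multiple of `e_∞`, which is not conjugate to any
`pencilVector`. -/
theorem direction_ne_zero {X : Submodule ℝ (Fin 6 → ℝ)} {c : EuclideanSpace ℝ (Fin 3)} {ρ f : ℝ}
    (h : ∀ x ∈ X, lieForm (pencilVector c ρ f) x = 0) {p : Fin 6 → ℝ} (hp : p ∈ X) (hp0 : p ≠ 0)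
    (h5 : p 5 = 0) (h3 : p 4 = p 3) : !₂[p 0, p 1, p 2] ≠ (0 : EuclideanSpace ℝ (Fin 3)) := by
  intro ha
  have h0 : p 0 = 0 := congrArg (fun x : EuclideanSpace ℝ (Fin 3) => x 0) ha
  have h1 : p 1 = 0 := congrArg (fun x : EuclideanSpace ℝ (Fin 3) => x 1) ha
  have h2 : p 2 = 0 := congrArg (fun x : EuclideanSpace ℝ (Fin 3) => x 2) ha
  have h4 := h p hp
  rw [lieForm_pencilVector_of_eq h5 h3, ha, inner_zero_left] at h4
  apply hp0
  ext k
  fin_cases k <;> simp [h0, h1, h2, h3, h5] <;> linarith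

/-- The centres of spheres that are conjugate to a projective plane lie in a Euclidean plane. -/
theorem exists_normal_of_conjugate {X : Submodule ℝ (Fin 6 → ℝ)} (hX : Module.finrank ℝ X = 3)
    {ι : Type*} [Nonempty ι] {c : ι → EuclideanSpace ℝ (Fin 3)} {ρ f : ι → ℝ}
    (h : ∀ k, ∀ x ∈ X, lieForm (pencilVector (c k) (ρ k) (f k)) x = 0) :
    ∃ v : EuclideanSpace ℝ (Fin 3), ∃ μ : ℝ, v ≠ 0 ∧ ![v 0, v 1, v 2, μ, μ, 0] ∈ X ∧
      ∀ k, inner ℝ v (c k) = μ := by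
  obtain ⟨p, hp, hp0, h5, h3⟩ := exists_mem_ne_zero_of_finrank_eq_three hX
    (LinearMap.proj 5) ((LinearMap.proj 4 : (Fin 6 → ℝ) →ₗ[ℝ] ℝ) - LinearMap.proj 3)
  replace h5 : p 5 = 0 := h5
  replace h3 : p 4 = p 3 := sub_eq_zero.1 h3
  obtain ⟨k⟩ := ‹Nonempty ι›
  refine ⟨!₂[p 0, p 1, p 2], p 3, direction_ne_zero (h k) hp hp0 h5 h3, ?_, fun k => ?_⟩
  · convert hp using 1
    ext k
    fin_cases k <;> simp [h3, h5]
  · have := h k p hp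
    rw [lieForm_pencilVector_of_eq h5 h3] at this
    linarith

/-- Spheres with non-collinear centres that are conjugate to a projective plane have a point `x` of
equal power. -/
theorem exists_radical_point {X : Submodule ℝ (Fin 6 → ℝ)} (hX : Module.finrank ℝ X = 3)
    {ι : Type*} [Nonempty ι] {c : ι → EuclideanSpace ℝ (Fin 3)} {ρ f : ι → ℝ}
    (h : ∀ k, ∀ x ∈ X, lieForm (pencilVector (c k) (ρ k) (f k)) x = 0)
    (hc : ¬ Collinear ℝ (Set.range c)) :
    ∃ v x : EuclideanSpace ℝ (Fin 3), ∃ μ τ : ℝ, v ≠ 0 ∧ inner ℝ v x = μ ∧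
      (∀ k, inner ℝ v (c k) = μ) ∧ ∀ k, 2 * inner ℝ (c k) x = ρ k + τ := by
  obtain ⟨v, μ, hv0, -, hv⟩ := exists_normal_of_conjugate hX h
  -- A second vector of `X`, with direction orthogonal to `v`. If it too represented a plane, the
  -- centres would lie on the intersection line of two planes; so it can be normalised to a point.
  obtain ⟨p, hp, hp0, h5, hpv⟩ := exists_mem_ne_zero_of_finrank_eq_three hX
    (LinearMap.proj 5)
    (v 0 • LinearMap.proj 0 + v 1 • LinearMap.proj 1 + v 2 • LinearMap.proj 2)
  replace h5 : p 5 = 0 := h5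
  replace hpv : v 0 * p 0 + v 1 * p 1 + v 2 * p 2 = 0 := hpv
  have hd : p 4 - p 3 ≠ 0 := by
    intro h3
    replace h3 : p 4 = p 3 := sub_eq_zero.1 h3
    obtain ⟨k⟩ := ‹Nonempty ι›
    set w : EuclideanSpace ℝ (Fin 3) := !₂[p 0, p 1, p 2] with hw
    have hw0 : w ≠ 0 := direction_ne_zero (h k) hp hp0 h5 h3
    refine hc (collinear_of_inner_eq (v := v) (w := w) (μ := μ) (ν := p 3) ?_ ?_ ?_)
    · rw [LinearIndependent.pair_iff' hv0]
      intro a ha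
      have hvw : inner ℝ v w = 0 := by
        rw [inner_euclidean_three]
        simpa [hw] using hpv
      rw [← ha, inner_smul_right, mul_eq_zero, inner_self_eq_zero, or_iff_left hv0] at hvw
      rw [hvw, zero_smul] at ha
      exact hw0 ha.symm
    · rintro _ ⟨k, rfl⟩
      exact hv k
    · rintro _ ⟨k, rfl⟩
      have := h k p hp
      rw [lieForm_pencilVector_of_eq h5 h3] at this
      linarith
  have hx := pencilVector_smul_eq hd
  rw [h5, zero_div] at hx
  set x : EuclideanSpace ℝ (Fin 3) := (p 4 - p 3)⁻¹ • !₂[p 0, p 1, p 2]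
  set τ := (p 3 + p 4) / (p 4 - p 3)
  have hmem : pencilVector x τ 0 ∈ X := by
    rw [← Submodule.smul_mem_iff _ hd, hx]
    exact hp
  clear_value x τ
  have hvv : inner ℝ v v ≠ 0 := inner_self_ne_zero.2 hv0
  -- The point is moved along the normal into the plane of the centres. Powers stay equal because
  -- `inner ℝ v (c k)` is the constant `μ`.
  set s := (μ - inner ℝ v x) / inner ℝ v v with hs
  refine ⟨v, x + s • v, μ, τ + 2 * s * μ, hv0, ?_, hv, fun k => ?_⟩
  · rw [inner_add_right, inner_smul_right, hs]
    field_simp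
    ring
  · have h1 := h k _ hmem
    rw [lieForm_pencilVector] at h1
    rw [inner_add_right, inner_smul_right, real_inner_comm v, hv k]
    linarith

/-- All spheres give `x` the same power `κ`, and `x - center` is orthogonal to `v`. Hence `x + θ v`
lies on a sphere exactly when `θ² |v|² + κ = 0`, a condition common to all of them. -/
theorem haveTwoCommonPoints_of_conjugate {X : Submodule ℝ (Fin 6 → ℝ)}
    (hX : Module.finrank ℝ X = 3) {S : ℤ → EuclideanGeometry.Sphere (EuclideanSpace ℝ (Fin 3))}
    (hr : ∀ k, 0 ≤ (S k).radius) {f : ℤ → ℝ}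
    (h : ∀ k, ∀ x ∈ X, lieForm
      (pencilVector (S k).center (‖(S k).center‖ ^ 2 - (S k).radius ^ 2) (f k)) x = 0)
    (hc : ¬ Collinear ℝ (Set.range fun k => (S k).center)) : HaveTwoCommonPoints S := by
  obtain ⟨v, x, μ, τ, hv0, hvx, hv, hx⟩ := exists_radical_point hX h hc
  have hvv : (v 0 ^ 2 + v 1 ^ 2 + v 2 ^ 2 : ℝ) ≠ 0 := by
    rw [← norm_sq_euclidean_three]
    simpa using hv0
  have hvvC : (v 0 ^ 2 + v 1 ^ 2 + v 2 ^ 2 : ℂ) ≠ 0 := by exact_mod_cast hvv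
  have hperp (k : ℤ) : v 0 * (x 0 - (S k).center 0) + v 1 * (x 1 - (S k).center 1) +
      v 2 * (x 2 - (S k).center 2) = 0 := by
    have h1 := hv k
    rw [← hvx, inner_euclidean_three, inner_euclidean_three] at h1
    linarith
  have hperpC (k : ℤ) : (v 0 * (x 0 - (S k).center 0) + v 1 * (x 1 - (S k).center 1) +
      v 2 * (x 2 - (S k).center 2) : ℂ) = 0 := by
    simpa using congrArg Complex.ofReal (hperp k)
  set κ := ‖x‖ ^ 2 - τ with hκ
  have hpow (k : ℤ) : (x 0 - (S k).center 0) ^ 2 + (x 1 - (S k).center 1) ^ 2 +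
      (x 2 - (S k).center 2) ^ 2 = (S k).radius ^ 2 + κ := by
    have h1 := hx k
    rw [inner_euclidean_three, norm_sq_euclidean_three] at h1
    rw [hκ, norm_sq_euclidean_three]
    linarith
  have hpowC (k : ℤ) : ((x 0 - (S k).center 0) ^ 2 + (x 1 - (S k).center 1) ^ 2 +
      (x 2 - (S k).center 2) ^ 2 : ℂ) = (S k).radius ^ 2 + κ := by exact_mod_cast hpow k
  have hmem (y : Fin 3 → ℂ) (θ : ℂ) (hy : ∀ i, y i = x i + θ * v i) (k : ℤ) :
      y ∈ complexSphere (S k) ↔ θ ^ 2 * (v 0 ^ 2 + v 1 ^ 2 + v 2 ^ 2 : ℂ) + κ = 0 := by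
    rw [complexSphere, Set.mem_ofPred_eq, Fin.sum_univ_three, hy, hy, hy,
      ← sub_eq_zero (b := ((S k).radius : ℂ) ^ 2)]
    have e : (x 0 + θ * v 0 - (S k).center 0 : ℂ) ^ 2 + (x 1 + θ * v 1 - (S k).center 1) ^ 2 +
        (x 2 + θ * v 2 - (S k).center 2) ^ 2 - (S k).radius ^ 2 =
        θ ^ 2 * (v 0 ^ 2 + v 1 ^ 2 + v 2 ^ 2 : ℂ) + κ := by
      linear_combination hpowC k + 2 * θ * hperpC k
    rw [e]
  obtain ⟨θ, hθ⟩ := IsAlgClosed.exists_pow_nat_eq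
    (-(κ : ℂ) / (v 0 ^ 2 + v 1 ^ 2 + v 2 ^ 2 : ℂ)) (n := 2) two_pos
  have hθ' : θ ^ 2 * (v 0 ^ 2 + v 1 ^ 2 + v 2 ^ 2 : ℂ) + κ = 0 := by
    rw [hθ]; field_simp; ring
  refine ⟨fun i => x i + θ * v i, fun i => x i + -θ * v i, ?_, fun hzw => ?_⟩
  · ext y
    rw [Set.mem_iInter, Set.mem_insert_iff, Set.mem_singleton_iff]
    constructor
    · intro hy
      have hlin (k : ℤ) : (∑ i, (y i - x i) ^ 2) + 2 * ∑ i, (y i - x i) * (x i - (S k).center i)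
          + κ = 0 := by
        have h1 := hy k
        rw [complexSphere, Set.mem_ofPred_eq, Fin.sum_univ_three] at h1
        rw [Fin.sum_univ_three, Fin.sum_univ_three]
        linear_combination h1 - hpowC k
      -- Used for the real and imaginary parts. If the image of `y - x` were not parallel to `v`, it
      -- would be a second independent vector with constant inner product with the centres, making
      -- them collinear.
      have hpar (g : ℂ →ₗ[ℝ] ℝ) : ∃ a : ℝ, ∀ i, g (y i - x i) = a * v i := by
        have hmulg (z : ℂ) (r : ℝ) : g (z * r) = g z * r := by
          rw [mul_comm, ← Complex.real_smul, map_smul, smul_eq_mul, mul_comm]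
        by_contra! hcon
        refine hc (collinear_of_inner_eq (v := v)
          (w := !₂[g (y 0 - x 0), g (y 1 - x 1), g (y 2 - x 2)]) (μ := μ)
          (ν := g ((y 0 - x 0) * x 0) + g ((y 1 - x 1) * x 1) + g ((y 2 - x 2) * x 2)
            + g (∑ i, (y i - x i) ^ 2) / 2 + g κ / 2) ?_ ?_ ?_)
        · rw [LinearIndependent.pair_iff' hv0]
          intro a ha
          obtain ⟨i, hi⟩ := hcon a
          apply hi
          have := congrArg (fun u : EuclideanSpace ℝ (Fin 3) => u i) ha
          fin_cases i <;> simpa using this.symm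
        · rintro _ ⟨k, rfl⟩
          exact hv k
        · rintro _ ⟨k, rfl⟩
          have h1 := congrArg g (hlin k)
          rw [← Complex.ofReal_ofNat, mul_comm, map_add, map_add, hmulg, map_zero,
            Fin.sum_univ_three (fun i => (y i - x i) * (x i - ((S k).center i : ℂ)))] at h1
          simp only [mul_sub, map_add, map_sub g (_ * _) (_ * _), hmulg] at h1 ⊢
          rw [inner_euclidean_three]
          simp only [Matrix.cons_val]
          linarith
      obtain ⟨a, ha⟩ := hpar Complex.reLm
      obtain ⟨b, hb⟩ := hpar Complex.imLm
      have hyx (i : Fin 3) : y i = x i + (⟨a, b⟩ : ℂ) * v i := by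
        rw [← sub_eq_iff_eq_add']
        apply Complex.ext
        · rw [Complex.re_mul_ofReal]; exact ha i
        · rw [Complex.im_mul_ofReal]; exact hb i
      have h2 := (hmem y _ hyx 0).1 (hy 0)
      have h3 : (⟨a, b⟩ : ℂ) ^ 2 = θ ^ 2 := by
        refine mul_right_cancel₀ hvvC ?_
        linear_combination h2 - hθ'
      rcases sq_eq_sq_iff_eq_or_eq_neg.1 h3 with h4 | h4
      · exact Or.inl (funext fun i => by rw [hyx, h4])
      · exact Or.inr (funext fun i => by rw [hyx, h4])
    · rintro (rfl | rfl) k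
      · exact (hmem _ θ (fun _ => rfl) k).2 hθ'
      · exact (hmem _ (-θ) (fun _ => rfl) k).2 (by rw [neg_sq, hθ'])
  -- Coincidence forces `θ v = 0`, hence `κ = 0`: all spheres pass through `x` and have `v` as a
  -- tangent direction there.
  · have h0 (i : Fin 3) : θ * v i = 0 := by
      have h1 : (x i + θ * v i : ℂ) = x i + -θ * v i := congrFun hzw i
      linear_combination h1 / 2
    have hκ0 : κ = 0 := by
      have h1 : (κ : ℂ) = 0 := by
        linear_combination hθ' - θ * v 0 * h0 0 - θ * v 1 * h0 1 - θ * v 2 * h0 2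
      exact_mod_cast h1
    refine ⟨x, v, hv0, fun k => ⟨?_, ?_⟩⟩
    · rw [EuclideanGeometry.mem_sphere, ← sq_eq_sq₀ dist_nonneg (hr k), dist_eq_norm,
        norm_sq_euclidean_three]
      have := hpow k
      rw [hκ0, add_zero] at this
      exact this
    · rw [inner_sub_right, hvx, hv, sub_self]

theorem exists_plane_of_normal {v : EuclideanSpace ℝ (Fin 3)} (hv : v ≠ 0)
    {ι : Type*} [Nonempty ι] {c : ι → EuclideanSpace ℝ (Fin 3)} {μ : ℝ}
    (h : ∀ k, inner ℝ v (c k) = μ) :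
    ∃ E : AffineSubspace ℝ (EuclideanSpace ℝ (Fin 3)), (∀ k, c k ∈ E) ∧
      Module.finrank ℝ E.direction = 2 ∧ E.directionᗮ = Submodule.span ℝ {v} := by
  obtain ⟨k₀⟩ := ‹Nonempty ι›
  refine ⟨AffineSubspace.mk' (c k₀) (Submodule.span ℝ {v})ᗮ, fun k => ?_, ?_, ?_⟩
  · rw [AffineSubspace.mem_mk', Submodule.mem_orthogonal_singleton_iff_inner_right, vsub_eq_sub,
      inner_sub_right, h, h, sub_self]
  · rw [AffineSubspace.direction_mk', finrank_orthogonal_euclidean_three,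
      finrank_span_singleton hv]
  · rw [AffineSubspace.direction_mk', Submodule.orthogonal_orthogonal]

/-! ### The spheres of the two families and the main theorem -/

/-- The spheres through the parameter lines of one family: they are unique, they have two common
points, and their centres lie in a plane whose normal is represented in the conjugate plane `X`. -/
theorem exists_row_spheres {l : SubspaceNet} (hl : IsLineNet l)
    (hs : ∀ j, Module.finrank ℝ (rowSpan l j) = 5) {Y X : Submodule ℝ (Fin 6 → ℝ)}
    (hX : Module.finrank ℝ X = 3) (hY : ∀ j, lieForm.orthogonal (rowSpan l j) ≤ Y)
    (hYX : ∀ y ∈ Y, ∀ x ∈ X, lieForm y x = 0)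
    {P : ℤ → ℤ → EuclideanSpace ℝ (Fin 3)} (hP : IsPointNetOf l P)
    (hc : ∀ j, ¬ Coplanar ℝ (Set.range fun i => P i j)) :
    ∃ H : ℤ → EuclideanGeometry.Sphere (EuclideanSpace ℝ (Fin 3)),
      (∀ j S, (∀ i, P i j ∈ S) ↔ S = H j) ∧
      (¬ Collinear ℝ (Set.range fun j => (H j).center) → HaveTwoCommonPoints H) ∧
      ∃ v : EuclideanSpace ℝ (Fin 3), ∃ μ : ℝ, v ≠ 0 ∧ ![v 0, v 1, v 2, μ, μ, 0] ∈ X ∧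
        ∀ j, inner ℝ v (H j).center = μ := by
  have hex (j : ℤ) : ∃ S : EuclideanGeometry.Sphere (EuclideanSpace ℝ (Fin 3)),
      (∀ T, (∀ i, P i j ∈ T) ↔ T = S) ∧
      ∃ f, pencilVector S.center (‖S.center‖ ^ 2 - S.radius ^ 2) f ∈ Y := by
    obtain ⟨⟨p, hp⟩, hp0, -⟩ := finrank_eq_one_iff'.1
      (show Module.finrank ℝ (lieForm.orthogonal (rowSpan l j)) = 1 by
        rw [finrank_lieForm_orthogonal, hs])
    replace hp0 : p ≠ 0 := fun h => hp0 (Subtype.ext h)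
    have hpl (i : ℤ) (x : Fin 6 → ℝ) (hx : x ∈ l i j) : lieForm x p = 0 :=
      hp x ((le_iSup (fun i => l i j) i) hx)
    refine exists_sphere_of_lieForm_eq_zero (hc j) (p := p) (fun hmem => ?_) (fun i => ?_)
      (hY j hp)
    -- If `p` were a multiple of `e₆`, the whole line `l 0 j` would lie in the polar hyperplane of
    -- `e₆`, which it meets only in a point.
    · obtain ⟨a, rfl⟩ := Submodule.mem_span_singleton.1 hmem
      have ha : a ≠ 0 := fun h => hp0 (by rw [h, zero_smul])
      have hle : l 0 j ≤ Submodule.span ℝ {liftPoint (P 0 j)} := by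
        rw [← hP 0 j]
        refine le_inf le_rfl fun x hx => ?_
        intro y hy
        obtain ⟨b, rfl⟩ := Submodule.mem_span_singleton.1 hy
        have h1 := hpl 0 x hx
        rw [map_smul, smul_eq_mul, mul_eq_zero, or_iff_right ha, lieForm_comm] at h1
        change lieForm _ _ = 0
        rw [map_smul, LinearMap.smul_apply, h1, smul_zero]
      have h1 := Submodule.finrank_mono hle
      have h2 := finrank_span_le_card (R := ℝ) ({liftPoint (P 0 j)} : Set (Fin 6 → ℝ))
      rw [Set.toFinset_singleton, Finset.card_singleton] at h2
      have := hl 0 j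
      omega
    · rw [lieForm_comm]
      refine hpl i _ ?_
      have h1 : liftPoint (P i j) ∈ l i j ⊓ _ :=
        (hP i j).ge (Submodule.mem_span_singleton_self _)
      exact h1.1
  choose H hH f hf using hex
  have hconj (j : ℤ) (x : Fin 6 → ℝ) (hx : x ∈ X) := hYX _ (hf j) x hx
  refine ⟨H, hH, haveTwoCommonPoints_of_conjugate hX (fun j => ?_) hconj,
    exists_normal_of_conjugate hX hconj⟩
  have h1 := EuclideanGeometry.mem_sphere.1 (((hH j (H j)).2 rfl) 0)
  exact h1 ▸ dist_nonneg

theorem mainTheorem11 (l : SubspaceNet)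
    (hl : IsPrincipalContactElementNet l)
    (hs : HasTwoSphericalFamilies l)
    (hA : IsDiscreteLineCongruence (laplaceA l)) (hA2 : IsLineNet (laplaceA^[2] l))
    (hB : IsDiscreteLineCongruence (laplaceB l)) (hB2 : IsLineNet (laplaceB^[2] l))
    (hrow : ∀ i j, ¬ rowMeet l j ≤ l i j ∧ ¬ rowMeet l j ≤ l i (j + 1))
    (hcol : ∀ i j, ¬ colMeet l i ≤ l i j ∧ ¬ colMeet l i ≤ l (i + 1) j) :
    LaplaceDegenerateA 2 l ∧ LaplaceDegenerateB 2 l ∧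
    (∃ Y X : Submodule ℝ (Fin 6 → ℝ),
      Module.finrank ℝ Y = 3 ∧ Module.finrank ℝ X = 3 ∧
      (∀ j, lieForm.orthogonal (rowSpan l j) ≤ Y) ∧
      (∀ i, lieForm.orthogonal (colSpan l i) ≤ X) ∧
      ∀ y ∈ Y, ∀ x ∈ X, lieForm y x = 0) ∧
    ∀ P : ℤ → ℤ → EuclideanSpace ℝ (Fin 3), IsPointNetOf l P →
      (∀ j, ¬ Coplanar ℝ (Set.range fun i => P i j)) →
      (∀ i, ¬ Coplanar ℝ (Set.range fun j => P i j)) →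
      ∃ H V : ℤ → EuclideanGeometry.Sphere (EuclideanSpace ℝ (Fin 3)),
        (∀ j S, (∀ i, P i j ∈ S) ↔ S = H j) ∧
        (∀ i S, (∀ j, P i j ∈ S) ↔ S = V i) ∧
        (¬ Collinear ℝ (Set.range fun j => (H j).center) → HaveTwoCommonPoints H) ∧
        (¬ Collinear ℝ (Set.range fun i => (V i).center) → HaveTwoCommonPoints V) ∧
        ∃ E F : AffineSubspace ℝ (EuclideanSpace ℝ (Fin 3)),
          (∀ j, (H j).center ∈ E) ∧ (∀ i, (V i).center ∈ F) ∧ OrthogonalPlanes E F := by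
  have hl' := hl.swap
  obtain ⟨o, ho⟩ := exists_row_centres hl hs.row_concurrent hrow
  obtain ⟨o', ho'⟩ := exists_row_centres hl' hs.col_concurrent fun i j => hcol j i
  replace ho' (i j : ℤ) := ho' j i
  have hconj := lieForm_centres_eq_zero hl hA.isLineNet ho ho'
  set U := Submodule.span ℝ (Set.range o) with hU
  set U' := Submodule.span ℝ (Set.range o') with hU'
  have h3' : 3 ≤ Module.finrank ℝ U' :=
    three_le_finrank_span_centres hl.1.1 (hs.row_spherical 0) fun i j => (ho' i j).2.2
  have h3 : 3 ≤ Module.finrank ℝ U :=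
    three_le_finrank_span_centres hl'.1.1 (hs.col_spherical 0) fun i j => (ho j i).2.2
  obtain ⟨hY3, hX3, hYX⟩ := span_centres_eq_orthogonal h3 h3' (span_le_orthogonal_span (by
    rintro _ ⟨j, rfl⟩ _ ⟨i, rfl⟩
    exact hconj i j))
  obtain ⟨-, -, hXY⟩ := span_centres_eq_orthogonal h3' h3 (span_le_orthogonal_span (by
    rintro _ ⟨i, rfl⟩ _ ⟨j, rfl⟩
    rw [lieForm_comm]
    exact hconj i j))
  -- Every `o' i` lies in the span of row `j`, so that span contains `U'`; polarity reverses the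
  -- inclusion.
  have hrowY (j : ℤ) : lieForm.orthogonal (rowSpan l j) ≤ U := by
    rw [hYX]
    refine LinearMap.BilinForm.orthogonal_le (Submodule.span_le.2 ?_)
    rintro _ ⟨i, rfl⟩
    exact sup_le (le_iSup (fun i => l i j) i) (le_iSup (fun i => l i j) (i + 1)) (ho' i j).1
  have hcolX (i : ℤ) : lieForm.orthogonal (colSpan l i) ≤ U' := by
    rw [hXY]
    refine LinearMap.BilinForm.orthogonal_le (Submodule.span_le.2 ?_)
    rintro _ ⟨j, rfl⟩
    exact sup_le (le_iSup (fun j => l i j) j) (le_iSup (fun j => l i j) (j + 1)) (ho i j).1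
  have hUU' (y : Fin 6 → ℝ) (hy : y ∈ U) (x : Fin 6 → ℝ) (hx : x ∈ U') : lieForm y x = 0 := by
    rw [lieForm_comm]
    exact (hYX.le hy) x hx
  refine ⟨laplaceDegenerateA_two hA hA2 ho', fun i i' j =>
    laplaceDegenerateA_two (l := fun i j => l j i) hB.swap (fun i j => hB2 j i)
      (fun i j => ho j i) j i i',
    ⟨U, U', hY3, hX3, hrowY, hcolX, hUU'⟩, fun P hP hPr hPc => ?_⟩
  obtain ⟨H, hH, hHc, v, μ, hv0, hv, hvH⟩ :=
    exists_row_spheres hl.1.1 hs.row_spherical hX3 hrowY hUU' hP hPr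
  obtain ⟨V, hV, hVc, w, ν, hw0, hw, hwV⟩ :=
    exists_row_spheres hl'.1.1 hs.col_spherical hY3 hcolX
      (fun x hx y hy => by rw [lieForm_comm]; exact hUU' y hy x hx)
      (P := fun i j => P j i) (fun i j => hP j i) hPc
  obtain ⟨E, hE, hE2, hEv⟩ := exists_plane_of_normal hv0 hvH
  obtain ⟨F, hF, hF2, hFw⟩ := exists_plane_of_normal hw0 hwV
  refine ⟨H, V, hH, hV, hHc, hVc, E, F, hE, hF, hE2, hF2, ?_⟩
  rw [hEv, hFw, Submodule.isOrtho_span]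
  rintro _ rfl _ rfl
  -- In the form of the two plane vectors the fourth and fifth coordinates cancel, leaving the inner
  -- product of the normals.
  have h := hUU' _ hw _ hv
  rw [lieForm_apply] at h
  rw [inner_euclidean_three]
  simp at h
  linarith
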